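/- **Theorem (known envelope bases).** Let $m,p$ be fixed. Consider the tensor response linear model $$Y_i=\mu_0+B\,\bar\times_{(m+1)}X_i+\varepsilon_i,\qquad i=1,2,\dots,$$ with responses $Y_i\in\mathbb R^{r_1\times\cdots\times r_m}$, predictors $X_i\in\mathbb R^p$, an intercept $\mu_0\in\mathbb R^{r_1\times\cdots\times r_m}$ and a coefficient tensor $B\in\mathbb R^{r_1\times\cdots\times r_m\times p}$, where $(B\,\bar\times_{(m+1)}x)_{i_1\ldots i_m}=\sum_{a=1}^p B_{i_1\ldots i_m a}\,x_a$. Suppose that the pairs $(X_i,\varepsilon_i)$ are i.i.d., that $X_i$ and $\varepsilon_i$ are independent, that $X_i$ has finite second moments and a positive definite covariance matrix $\Sigma_X=\mathrm{cov}(X_i)$, and that $\mathrm{vec}(\varepsilon_i)\sim N(0,\Sigma_m\otimes\cdots\otimes\Sigma_1)$ with $\Sigma_k\in\mathbb R^{r_k\times r_k}$ symmetric positive definite. For each $k$ let $\mathcal E_k\subseteq\mathbb R^{r_k}$ be the $\Sigma_k$-envelope of $\mathrm{span}(B_{(k)})$: the intersection of all subspaces $\mathcal R\supseteq\mathrm{span}(B_{(k)})$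 with $\Sigma_k=P_{\mathcal R}\Sigma_kP_{\mathcal R}+Q_{\mathcal R}\Sigma_kQ_{\mathcal R}$, where $B_{(k)}$ is the mode-$k$ matricization of $B$, $P_{\mathcal R}$ is the orthogonal projection onto $\mathcal R$ and $Q_{\mathcal R}=I-P_{\mathcal R}$. Let $\Gamma_k\in\mathbb R^{r_k\times u_k}$ be known matrices whose columns form an orthonormal basis of $\mathcal E_k$, and put $P_k=\Gamma_k\Gamma_k^{\mathsf T}$. Given a sample $(x_t,y_t)_{t\le n}$, write $\mathbb X=(x_1,\dots,x_n)\in\mathbb R^{p\times n}$, form the core tensors $z_t=[\![y_t;\Gamma_1^{\mathsf T},\dots,\Gamma_m^{\mathsf T}]\!]$ (multiply $y_t$ by $\Gamma_k^{\mathsf T}$ along each mode $k$), stack them into $\mathbb Z\in\mathbb R^{u_1\times\cdots\times u_m\times n}$, and set $\widehat\Theta=\mathbb Z\times_{(m+1)}\{(\mathbb X\mathbb X^{\mathsf T})^{-1}\mathbb X\}$ and $\widehat B_\Gamma=[\![\widehat\Theta;\Gamma_1,\dots,\Gamma_m,I_p]\!]$ (when $\mathbb X\mathbb X^{\mathsf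 T}$ is singular the value of $\widehat B_\Gamma$ is set to $0$). Let $\widehat B_\Gamma$ be computed either from the centered sample $x_t=X_t-\bar X$, $y_t=Y_t-\bar Y$ (with the sample means of size $n$), or, in case $\mu_0=0$ and $\mathbb E X_i=0$, from $x_t=X_t$, $y_t=Y_t$. In both cases, as $n\to\infty$, $\widehat B_\Gamma$ is $\sqrt n$-consistent, i.e. $\sqrt n\,(\widehat B_\Gamma-B)$ is bounded in probability, and $$\sqrt n\,\{\mathrm{vec}(\widehat B_\Gamma)-\mathrm{vec}(B)\}\ \xrightarrow{\ d\ }\ N(0,U_\Gamma),\qquad U_\Gamma=\Sigma_X^{-1}\otimes P_m\Sigma_mP_m\otimes\cdots\otimes P_1\Sigma_1P_1 .$$ Moreover there are matrices $\Gamma_{0k}\in\mathbb R^{r_k\times(r_k-u_k)}$ completing $\Gamma_k$ to an orthonormal basis of $\mathbb R^{r_k}$ and symmetric positive definite $\Omega_k$, $\Omega_{0k}$ such that $\Sigma_k=\Gamma_k\Omega_k\Gamma_k^{\mathsf T}+\Gamma_{0k}\Omega_{0k}\Gamma_{0k}^{\mathsf T}$ for $k=1,\dots,m$, and for all such matrices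 $$U_\Gamma=\Sigma_X^{-1}\otimes\Gamma_m\Omega_m\Gamma_m^{\mathsf T}\otimes\cdots\otimes\Gamma_1\Omega_1\Gamma_1^{\mathsf T}.$$ -/

import Mathlib

open MeasureTheory ProbabilityTheory Filter
open scoped Matrix Kronecker Topology

noncomputable section

namespace TensorEnvelope

/-- Tensors of order `m` and dimensions `r 0 × ⋯ × r (m - 1)`. -/
abbrev Tensor {m : ℕ} (r : Fin m → ℕ) : Type := (∀ k, Fin (r k)) → ℝ

/-- Coefficient tensors: order `m + 1`, dimensions `r 0 × ⋯ × r (m - 1) × p`; the last mode is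
the second argument. -/
abbrev CoefTensor {m : ℕ} (r : Fin m → ℕ) (p : ℕ) : Type := (∀ k, Fin (r k)) → Fin p → ℝ

/-- `vec` of a tensor, as a Euclidean vector whose positions are the multi-indices. -/
def vec {m : ℕ} {r : Fin m → ℕ} (A : Tensor r) : EuclideanSpace ℝ (∀ k, Fin (r k)) :=
  WithLp.toLp 2 A

/-- `vec` of a coefficient tensor. A position is a pair (index of the last mode, multi-index of the
first `m` modes), as in Mathlib's column-stacking `Matrix.vec`, so that covariance matrices of
`vec B` have the form `(p × p matrix) ⊗ₖ (matrix over the first m modes)`. -/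
def vecCoef {m : ℕ} {r : Fin m → ℕ} {p : ℕ} (B : CoefTensor r p) :
    EuclideanSpace ℝ (Fin p × (∀ k, Fin (r k))) :=
  WithLp.toLp 2 fun x => B x.2 x.1

/-- The Kronecker product `A_m ⊗ ⋯ ⊗ A_1`; rows and columns are indexed by multi-indices, in
accordance with `vec`. -/
def kron {m : ℕ} {r : Fin m → ℕ} (A : ∀ k, Matrix (Fin (r k)) (Fin (r k)) ℝ) :
    Matrix (∀ k, Fin (r k)) (∀ k, Fin (r k)) ℝ :=
  Matrix.of fun i j => ∏ k, A k (i k) (j k)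

/-- The Tucker product `⟦A; C_1, …, C_m⟧`: multiply by `C_k` along mode `k`, for every `k`. -/
def tucker {m : ℕ} {r u : Fin m → ℕ} (A : Tensor u)
    (C : ∀ k, Matrix (Fin (r k)) (Fin (u k)) ℝ) : Tensor r :=
  fun i => ∑ j, (∏ k, C k (i k) (j k)) * A j

/-- The Tucker product `⟦A; C_1, …, C_m, I_p⟧` of a coefficient tensor. -/
def tuckerCoef {m : ℕ} {r u : Fin m → ℕ} {p : ℕ} (A : CoefTensor u p)
    (C : ∀ k, Matrix (Fin (r k)) (Fin (u k)) ℝ) : CoefTensor r p :=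
  fun i a => tucker (fun j => A j a) C i

/-- The `(m+1)`-mode vector product of a coefficient tensor and a predictor vector. -/
def modeVecProd {m : ℕ} {r : Fin m → ℕ} {p : ℕ} (B : CoefTensor r p) (x : Fin p → ℝ) : Tensor r :=
  fun i => ∑ a, B i a * x a

/-- The span of the columns of the mode-`k` matricization of `B`, that is, of the mode-`k` fibers
of `B`. -/
def modeSpan {m : ℕ} {r : Fin m → ℕ} {p : ℕ} (B : CoefTensor r p) (k : Fin m) :
    Submodule ℝ (EuclideanSpace ℝ (Fin (r k))) :=
  Submodule.span ℝ (Set.range fun x : (∀ l, Fin (r l)) × Fin p =>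
    WithLp.toLp 2 fun i : Fin (r k) => B (Function.update x.1 k i) x.2)

/-- `R` is a reducing subspace of `M`: `M = P_R M P_R + Q_R M Q_R`, with `P_R` and `Q_R` the
orthogonal projections onto `R` and its orthogonal complement. -/
def IsReducing {d : ℕ} (M : Matrix (Fin d) (Fin d) ℝ)
    (R : Submodule ℝ (EuclideanSpace ℝ (Fin d))) : Prop :=
  Matrix.toEuclideanCLM (𝕜 := ℝ) M =
    R.starProjection ∘L Matrix.toEuclideanCLM (𝕜 := ℝ) M ∘L R.starProjection +
      Rᗮ.starProjection ∘L Matrix.toEuclideanCLM (𝕜 := ℝ) M ∘L Rᗮ.starProjection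

/-- The `M`-envelope of `V`: the intersection of all reducing subspaces of `M` that contain `V`. -/
def envelope {d : ℕ} (M : Matrix (Fin d) (Fin d) ℝ)
    (V : Submodule ℝ (EuclideanSpace ℝ (Fin d))) : Submodule ℝ (EuclideanSpace ℝ (Fin d)) :=
  sInf {R | IsReducing M R ∧ V ≤ R}

/-- The columns of `G` form an orthonormal basis of the subspace `R`. -/
def IsBasisMatrix {d u : ℕ} (G : Matrix (Fin d) (Fin u) ℝ)
    (R : Submodule ℝ (EuclideanSpace ℝ (Fin d))) : Prop :=
  Gᵀ * G = 1 ∧ Submodule.span ℝ (Set.range fun j => WithLp.toLp 2 fun i => G i j) = R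

/-- The coordinate representation `S = G Om Gᵀ + G₀ Om₀ G₀ᵀ`, with `Om`, `Om₀` symmetric positive
definite and the columns of `G₀` completing those of `G` to an orthonormal basis. -/
def IsDecomposition {d u : ℕ} (S : Matrix (Fin d) (Fin d) ℝ) (G : Matrix (Fin d) (Fin u) ℝ)
    (G₀ : Matrix (Fin d) (Fin (d - u)) ℝ) (Om : Matrix (Fin u) (Fin u) ℝ)
    (Om₀ : Matrix (Fin (d - u)) (Fin (d - u)) ℝ) : Prop :=
  G₀ᵀ * G₀ = 1 ∧ Gᵀ * G₀ = 0 ∧ G * Gᵀ + G₀ * G₀ᵀ = 1 ∧ Om.PosDef ∧ Om₀.PosDef ∧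
    S = G * Om * Gᵀ + G₀ * Om₀ * G₀ᵀ

/-- Ordinary least squares without intercept: `𝕐 ×_{m+1} {(𝕏 𝕏ᵀ)⁻¹ 𝕏}`, where `𝕏` is the `p × n`
matrix with columns `x t` and `𝕐` stacks the tensors `y t`. -/
def ols {m : ℕ} {r : Fin m → ℕ} {p n : ℕ} (x : Fin n → Fin p → ℝ) (y : Fin n → Tensor r) :
    CoefTensor r p :=
  let XX : Matrix (Fin p) (Fin n) ℝ := Matrix.of fun a t => x t a
  fun i a => ∑ t, y t i * ((XX * XXᵀ)⁻¹ * XX) a t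

/-- The envelope estimator of the coefficient tensor for known envelope bases `G k`: regress the
core tensors `⟦y_t; G_1ᵀ, …, G_mᵀ⟧` on `x_t` by ordinary least squares, which gives `Θ`, and
take `⟦Θ; G_1, …, G_m, I_p⟧`. -/
def envelopeEstimator {m : ℕ} {r u : Fin m → ℕ} {p n : ℕ}
    (G : ∀ k, Matrix (Fin (r k)) (Fin (u k)) ℝ)
    (x : Fin n → Fin p → ℝ) (y : Fin n → Tensor r) : CoefTensor r p :=
  tuckerCoef (ols x fun t => tucker (y t) fun k => (G k)ᵀ) G

/-- Centering a sample at its sample mean. -/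
def center {E : Type*} [AddCommGroup E] [Module ℝ E] {n : ℕ} (z : Fin n → E) : Fin n → E :=
  fun t => z t - (n : ℝ)⁻¹ • ∑ s, z s

/-- The covariance matrix of a random vector. -/
def covMatrix {Ω : Type*} [MeasurableSpace Ω] (P : Measure Ω) {p : ℕ} (X : Ω → Fin p → ℝ) :
    Matrix (Fin p) (Fin p) ℝ :=
  Matrix.of fun a b => cov[fun ω => X ω a, fun ω => X ω b; P]

/-- The matrix `Σ_X⁻¹ ⊗ P_m Σ_m P_m ⊗ ⋯ ⊗ P_1 Σ_1 P_1`, with `P_k = G_k G_kᵀ`. -/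
def asymptoticCov {m p : ℕ} {r u : Fin m → ℕ} (SX : Matrix (Fin p) (Fin p) ℝ)
    (S : ∀ k, Matrix (Fin (r k)) (Fin (r k)) ℝ) (G : ∀ k, Matrix (Fin (r k)) (Fin (u k)) ℝ) :
    Matrix (Fin p × (∀ k, Fin (r k))) (Fin p × (∀ k, Fin (r k))) ℝ :=
  SX⁻¹ ⊗ₖ kron fun k => (G k * (G k)ᵀ) * S k * (G k * (G k)ᵀ)

/-- `√n`-consistency of the estimators `Bhat n` for `B`: `√n (Bhat n - B)` is bounded in
probability. -/
def IsSqrtConsistent {Ω : Type*} [MeasurableSpace Ω] (P : Measure Ω) {m : ℕ} {r : Fin m → ℕ}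
    {p : ℕ} (Bhat : ℕ → Ω → CoefTensor r p) (B : CoefTensor r p) : Prop :=
  ∀ δ : ENNReal, 0 < δ → ∃ M : ℝ, ∀ᶠ n : ℕ in atTop,
    P {ω | M < √(n : ℝ) * ‖vecCoef (Bhat n ω) - vecCoef B‖} ≤ δ

/-- Asymptotic normality with asymptotic covariance `U`: `√n (vec (Bhat n) - vec B)` converges in
distribution to `N(0, U)`. -/
def IsAsymptoticallyNormal {Ω : Type*} [MeasurableSpace Ω] (P : Measure Ω) [IsProbabilityMeasure P]
    {m : ℕ} {r : Fin m → ℕ} {p : ℕ} (Bhat : ℕ → Ω → CoefTensor r p) (B : CoefTensor r p)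
    (U : Matrix (Fin p × (∀ k, Fin (r k))) (Fin p × (∀ k, Fin (r k))) ℝ) : Prop :=
  TendstoInDistribution (fun (n : ℕ) ω => √(n : ℝ) • (vecCoef (Bhat n ω) - vecCoef B)) atTop
    (id : EuclideanSpace ℝ (Fin p × (∀ k, Fin (r k))) → _) (fun _ => P) (multivariateGaussian 0 U)

end TensorEnvelope

end

/-! Write `K` for the Kronecker product of the projections `G k * (G k)ᵀ`. Compressing to core
tensors and expanding back is multiplication by `K` (`tucker_tucker_transpose`), so the estimator is
ordinary least squares applied to the responses `K y_t`. Each envelope contains the mode-`k` fibers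
of `B`, hence `K` fixes `B` (`kron_mulVec_coef`). The estimation error is therefore a weighted sum
of the vectors `K ε_t`, plus a bias that vanishes once the Gram matrix is invertible
(`vecCoef_envelopeEstimator_sub`). Centering changes nothing here: the intercept cancels, and the
mean error is a common shift, which centered weights annihilate.

No central limit theorem is needed. Given the predictors, the weighted sum is exactly Gaussian with
covariance `(gram x)⁻¹ ⊗ₖ (K * kron S * Kᵀ)`. Integrating out the errors writes the characteristic
function of the scaled error as an expectation over predictors only (`charFun_map_estimationError`).
By the strong law, `n⁻¹ • gram` tends almost surely to the predictor covariance. The integrand has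
modulus at most one, so dominated convergence yields the Gaussian limit
(`tendsto_charFun_estimationError`). Lévy's theorem gives asymptotic normality, and the tightness it
entails gives `√n`-consistency.

For the second form of the covariance, the envelope is itself reducing, so `S k` splits into blocks
along it and its complement; sandwiching by the projection leaves the first block. -/

namespace TensorEnvelope

/-! ### Kronecker products acting on tensors -/

section Kronecker

variable {m : ℕ} {r u : Fin m → ℕ}

lemma kron_mul_kron (A C : ∀ k, Matrix (Fin (r k)) (Fin (r k)) ℝ) :
    kron A * kron C = kron fun k => A k * C k := by
  ext i j
  simp only [kron, Matrix.mul_apply, Matrix.of_apply, ← Finset.prod_mul_distrib]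
  rw [Finset.prod_univ_sum, Fintype.piFinset_univ]

lemma transpose_kron (A : ∀ k, Matrix (Fin (r k)) (Fin (r k)) ℝ) :
    (kron A)ᵀ = kron fun k => (A k)ᵀ := rfl

-- Positive square roots of the factors exhibit the Kronecker product as a matrix of the form `Cᴴ *
-- C`.
open scoped MatrixOrder in
lemma posSemidef_kron {A : ∀ k, Matrix (Fin (r k)) (Fin (r k)) ℝ} (hA : ∀ k, (A k).PosSemidef) :
    (kron A).PosSemidef := by
  have : kron A = (kron fun k => CFC.sqrt (A k))ᴴ * kron fun k => CFC.sqrt (A k) := by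
    rw [Matrix.conjTranspose_eq_transpose_of_trivial, transpose_kron, kron_mul_kron]
    congr 1
    ext1 k
    have h : (CFC.sqrt (A k))ᴴ = CFC.sqrt (A k) := (CFC.sqrt_nonneg (A k)).isSelfAdjoint
    rw [← Matrix.conjTranspose_eq_transpose_of_trivial, h,
      CFC.sqrt_mul_sqrt_self _ (hA k).nonneg]
  rw [this]
  exact Matrix.posSemidef_conjTranspose_mul_self _

lemma tucker_tucker_transpose (y : Tensor r) (G : ∀ k, Matrix (Fin (r k)) (Fin (u k)) ℝ) :
    tucker (tucker y fun k => (G k)ᵀ) G = kron (fun k => G k * (G k)ᵀ) *ᵥ y := by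
  ext i
  simp only [tucker, kron, Matrix.mulVec, dotProduct, Matrix.of_apply, Matrix.mul_apply,
    Matrix.transpose_apply, Finset.mul_sum]
  rw [Finset.sum_comm]
  refine Finset.sum_congr rfl fun l _ => ?_
  rw [Finset.prod_univ_sum, Fintype.piFinset_univ, Finset.sum_mul]
  refine Finset.sum_congr rfl fun j _ => ?_
  rw [Finset.prod_mul_distrib, mul_assoc]

/-- Multiplication along a single mode, as a Kronecker product. -/
lemma kron_single_mulVec (k : Fin m) (A : ∀ k, Matrix (Fin (r k)) (Fin (r k)) ℝ) (b : Tensor r)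
    (i : ∀ k, Fin (r k)) :
    (kron (fun l => if l = k then A l else 1) *ᵥ b) i =
      ∑ x, A k (i k) x * b (Function.update i k x) := by
  simp only [kron, Matrix.mulVec, dotProduct, Matrix.of_apply]
  symm
  -- Only multi-indices that agree with `i` away from mode `k` contribute; any other one meets an
  -- off-diagonal entry of an identity factor.
  refine Finset.sum_of_injOn (fun x => Function.update i k x)
    (fun x _ y _ h => Function.update_injective i k h) (by simp) ?_ ?_
  · intro j _ hj
    have : ∃ l, l ≠ k ∧ i l ≠ j l := by
      by_contra! h
      refine hj ⟨j k, by simp, ?_⟩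
      ext1 l
      by_cases hl : l = k
      · subst hl; simp
      · simp [hl, h l hl]
    obtain ⟨l, hl, hne⟩ := this
    rw [Finset.prod_eq_zero (Finset.mem_univ l) (by simp [hl, hne]), zero_mul]
  · intro x _
    congr 1
    rw [Finset.prod_eq_single k]
    · simp
    · intro l _ hl
      rw [Function.update_of_ne hl, if_neg hl, Matrix.one_apply_eq]
    · simp

/-- The Kronecker product is a product of single-mode multiplications, each of which fixes `b`; the
induction switches on one mode at a time. -/
lemma kron_mulVec_eq_self (A : ∀ k, Matrix (Fin (r k)) (Fin (r k)) ℝ) (b : Tensor r)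
    (h : ∀ k i, ∑ x, A k (i k) x * b (Function.update i k x) = b i) : kron A *ᵥ b = b := by
  have key : ∀ s : Finset (Fin m), kron (fun k => if k ∈ s then A k else 1) *ᵥ b = b := by
    intro s
    induction s using Finset.induction_on with
    | empty =>
      have : kron (fun k => if k ∈ (∅ : Finset (Fin m)) then A k else 1) = 1 := by
        ext i j
        simp only [kron, Matrix.of_apply, Finset.notMem_empty, if_false, Matrix.one_apply]
        rw [Finset.prod_ite_zero]
        simp [funext_iff]
      rw [this, Matrix.one_mulVec]
    | insert k s hk ih =>
      have : kron (fun l => if l ∈ insert k s then A l else 1) =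
          kron (fun l => if l ∈ s then A l else 1) * kron (fun l => if l = k then A l else 1) := by
        rw [kron_mul_kron]
        congr 1
        ext1 l
        by_cases hl : l = k
        · subst hl; simp [hk]
        · simp [hl]
      have h1 : kron (fun l => if l = k then A l else 1) *ᵥ b = b := by
        ext i
        rw [kron_single_mulVec, h]
      rw [this, ← Matrix.mulVec_mulVec, h1, ih]
  simpa using key Finset.univ

end Kronecker

/-! ### Reducing subspaces, envelopes and block decompositions -/

section Envelope

variable {d u : ℕ}

lemma IsBasisMatrix.mul_transpose_mulVec {G : Matrix (Fin d) (Fin u) ℝ}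
    {R : Submodule ℝ (EuclideanSpace ℝ (Fin d))} (hG : IsBasisMatrix G R)
    {v : EuclideanSpace ℝ (Fin d)} (hv : v ∈ R) : (G * Gᵀ) *ᵥ v.ofLp = v.ofLp := by
  rw [← hG.2] at hv
  induction hv using Submodule.span_induction with
  | mem x hx =>
    obtain ⟨j, rfl⟩ := hx
    have h : G * Gᵀ * G = G := by rw [Matrix.mul_assoc, hG.1, Matrix.mul_one]
    ext i
    exact congrFun (congrFun h i) j
  | zero => simp
  | add x y _ _ hx hy => simp [Matrix.mulVec_add, hx, hy]
  | smul c x _ hx => simp [Matrix.mulVec_smul, hx]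

lemma inner_toEuclideanCLM_comm {M : Matrix (Fin d) (Fin d) ℝ} (hM : M.IsHermitian)
    (x y : EuclideanSpace ℝ (Fin d)) :
    inner ℝ (Matrix.toEuclideanCLM (𝕜 := ℝ) M x) y =
      inner ℝ x (Matrix.toEuclideanCLM (𝕜 := ℝ) M y) := by
  have h : IsSelfAdjoint (Matrix.toEuclideanCLM (𝕜 := ℝ) M) :=
    IsSelfAdjoint.map (show IsSelfAdjoint M from hM) _
  rw [← ContinuousLinearMap.adjoint_inner_right, h.adjoint_eq]

/-- Reducing subspaces of a symmetric matrix are its invariant subspaces. -/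
lemma isReducing_iff {M : Matrix (Fin d) (Fin d) ℝ} (hM : M.IsHermitian)
    (R : Submodule ℝ (EuclideanSpace ℝ (Fin d))) :
    IsReducing M R ↔ ∀ x ∈ R, Matrix.toEuclideanCLM (𝕜 := ℝ) M x ∈ R := by
  constructor
  · intro h x hx
    have hx' : Rᗮ.starProjection x = 0 := by
      rw [Submodule.starProjection_apply_eq_zero_iff, Submodule.orthogonal_orthogonal]
      exact hx
    have := congrArg (fun T => T x) h
    simp only [_root_.add_apply, ContinuousLinearMap.comp_apply, hx', map_zero,
      add_zero] at this
    rw [this]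
    exact Submodule.starProjection_apply_mem _ _
  · intro h
    -- By symmetry of `M`, invariance passes to the orthogonal complement.
    have h' : ∀ x ∈ Rᗮ, Matrix.toEuclideanCLM (𝕜 := ℝ) M x ∈ Rᗮ := by
      intro x hx y hy
      rw [← inner_toEuclideanCLM_comm hM]
      exact hx _ (h y hy)
    unfold IsReducing
    ext1 x
    simp only [_root_.add_apply, ContinuousLinearMap.comp_apply]
    rw [Submodule.starProjection_eq_self_iff.2 (h _ (Submodule.starProjection_apply_mem R x)),
      Submodule.starProjection_eq_self_iff.2 (h' _ (Submodule.starProjection_apply_mem Rᗮ x)),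
      ← map_add, Submodule.starProjection_add_starProjection_orthogonal]

/-- Invariance, unlike the defining projection identity, visibly passes to intersections. -/
lemma isReducing_envelope {M : Matrix (Fin d) (Fin d) ℝ} (hM : M.IsHermitian)
    (V : Submodule ℝ (EuclideanSpace ℝ (Fin d))) : IsReducing M (envelope M V) := by
  rw [isReducing_iff hM]
  intro x hx
  simp only [envelope, Submodule.mem_sInf] at hx ⊢
  exact fun R hR => (isReducing_iff hM R).1 hR.1 x (hx R hR)

lemma le_envelope (M : Matrix (Fin d) (Fin d) ℝ)
    (V : Submodule ℝ (EuclideanSpace ℝ (Fin d))) : V ≤ envelope M V :=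
  le_sInf fun _ hR => hR.2

lemma IsBasisMatrix.orthonormal {G : Matrix (Fin d) (Fin u) ℝ}
    {R : Submodule ℝ (EuclideanSpace ℝ (Fin d))} (hG : IsBasisMatrix G R) :
    Orthonormal ℝ fun j => (WithLp.toLp 2 fun i => G i j : EuclideanSpace ℝ (Fin d)) := by
  rw [orthonormal_iff_ite]
  intro i j
  have := congrFun (congrFun hG.1 i) j
  simp only [Matrix.mul_apply, Matrix.transpose_apply, Matrix.one_apply] at this
  rw [← this]
  simp [PiLp.inner_apply, mul_comm]

lemma IsBasisMatrix.exists_complement {G : Matrix (Fin d) (Fin u) ℝ}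
    {R : Submodule ℝ (EuclideanSpace ℝ (Fin d))} (hG : IsBasisMatrix G R) :
    ∃ G₀ : Matrix (Fin d) (Fin (d - u)) ℝ,
      G₀ᵀ * G₀ = 1 ∧ Gᵀ * G₀ = 0 ∧ G * Gᵀ + G₀ * G₀ᵀ = 1 := by
  have hR : Module.finrank ℝ R = u := by
    rw [← hG.2, finrank_span_eq_card hG.orthonormal.linearIndependent, Fintype.card_fin]
  have hsum := R.finrank_add_finrank_orthogonal
  rw [hR, finrank_euclideanSpace_fin] at hsum
  have hR' : Module.finrank ℝ Rᗮ = d - u := by omega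
  let b := (stdOrthonormalBasis ℝ Rᗮ).reindex (finCongr hR')
  let G₀ : Matrix (Fin d) (Fin (d - u)) ℝ :=
    Matrix.of fun i j => (b j : EuclideanSpace ℝ (Fin d)) i
  have h1 : G₀ᵀ * G₀ = 1 := by
    ext i j
    have := (orthonormal_iff_ite.1 b.orthonormal) i j
    rw [Matrix.one_apply, ← this, Submodule.coe_inner]
    simp [Matrix.mul_apply, PiLp.inner_apply, G₀, mul_comm]
  have h2 : Gᵀ * G₀ = 0 := by
    ext i j
    have hm : (WithLp.toLp 2 fun l => G l i : EuclideanSpace ℝ (Fin d)) ∈ R := by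
      rw [← hG.2]; exact Submodule.subset_span ⟨i, rfl⟩
    have := (b j).2 _ hm
    rw [Matrix.zero_apply, ← this]
    simp [Matrix.mul_apply, PiLp.inner_apply, G₀, mul_comm]
  have h3 : G₀ᵀ * G = 0 := by
    rw [← Matrix.transpose_transpose (G₀ᵀ * G), Matrix.transpose_mul, Matrix.transpose_transpose,
      h2, Matrix.transpose_zero]
  refine ⟨G₀, h1, h2, ?_⟩
  -- The matrix with column blocks `G` and `G₀` is square, since `u ≤ d` by the dimension count, so
  -- its left inverse is also a right inverse.
  have e : Fin d ≃ Fin u ⊕ Fin (d - u) :=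
    (finCongr (by omega)).trans finSumFinEquiv.symm
  rw [← Matrix.fromCols_mul_fromRows, Matrix.fromCols_mul_fromRows_eq_one_comm e,
    Matrix.fromRows_mul_fromCols, hG.1, h1, h2, h3, Matrix.fromBlocks_one]

lemma posDef_transpose_mul_mul {S : Matrix (Fin d) (Fin d) ℝ} (hS : S.PosDef)
    {G : Matrix (Fin d) (Fin u) ℝ} (hG : Gᵀ * G = 1) : (Gᵀ * S * G).PosDef := by
  rw [← Matrix.conjTranspose_eq_transpose_of_trivial]
  refine hS.conjTranspose_mul_mul_same fun x y hxy => ?_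
  have := congrArg (fun z => Gᵀ *ᵥ z) hxy
  simpa [hG] using this

lemma IsBasisMatrix.exists_isDecomposition {S : Matrix (Fin d) (Fin d) ℝ} (hS : S.PosDef)
    {G : Matrix (Fin d) (Fin u) ℝ} {R : Submodule ℝ (EuclideanSpace ℝ (Fin d))}
    (hG : IsBasisMatrix G R) (hR : IsReducing S R) :
    ∃ G₀ Om Om₀, IsDecomposition S G G₀ Om Om₀ := by
  obtain ⟨G₀, h1, h2, h3⟩ := hG.exists_complement
  refine ⟨G₀, Gᵀ * S * G, G₀ᵀ * S * G₀, h1, h2, h3, posDef_transpose_mul_mul hS hG.1,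
    posDef_transpose_mul_mul hS h1, ?_⟩
  have hSt : Sᵀ = S := by
    rw [← Matrix.conjTranspose_eq_transpose_of_trivial]; exact hS.1
  -- By invariance the columns of `S * G` stay in `R`, where `G * Gᵀ` acts as the identity.
  -- Transposing the consequence `hPS` shows that `S` commutes with the projection.
  have hinv : G * Gᵀ * (S * G) = S * G := by
    ext i j
    have hm : (WithLp.toLp 2 fun l => G l j : EuclideanSpace ℝ (Fin d)) ∈ R := by
      rw [← hG.2]; exact Submodule.subset_span ⟨j, rfl⟩
    have := hG.mul_transpose_mulVec ((isReducing_iff hS.1 R).1 hR _ hm)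
    exact congrFun this i
  have hPS : G * Gᵀ * S * (G * Gᵀ) = S * (G * Gᵀ) := by
    calc G * Gᵀ * S * (G * Gᵀ) = G * Gᵀ * (S * G) * Gᵀ := by simp only [Matrix.mul_assoc]
      _ = S * (G * Gᵀ) := by rw [hinv, Matrix.mul_assoc]
  have hSP : G * Gᵀ * S * (G * Gᵀ) = G * Gᵀ * S := by
    have := congrArg Matrix.transpose hPS
    simpa [Matrix.transpose_mul, hSt, Matrix.mul_assoc] using this
  have hQ : G₀ * G₀ᵀ = 1 - G * Gᵀ := by rw [← h3]; abel
  calc S = G * Gᵀ * S * (G * Gᵀ) + (1 - G * Gᵀ) * S * (1 - G * Gᵀ) := by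
        simp only [Matrix.sub_mul, Matrix.mul_sub, Matrix.one_mul, Matrix.mul_one]
        rw [hSP, ← hPS, hSP]
        abel
    _ = _ := by
        rw [← hQ]
        simp only [Matrix.mul_assoc]

/-- Orthogonality `Gᵀ * G₀ = 0` kills the complementary block. -/
lemma IsDecomposition.proj_mul_proj {S : Matrix (Fin d) (Fin d) ℝ} {G : Matrix (Fin d) (Fin u) ℝ}
    {G₀ : Matrix (Fin d) (Fin (d - u)) ℝ} {Om : Matrix (Fin u) (Fin u) ℝ}
    {Om₀ : Matrix (Fin (d - u)) (Fin (d - u)) ℝ} (hG : Gᵀ * G = 1)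
    (h : IsDecomposition S G G₀ Om Om₀) : G * Gᵀ * S * (G * Gᵀ) = G * Om * Gᵀ := by
  obtain ⟨-, h2, -, -, -, hS⟩ := h
  calc G * Gᵀ * S * (G * Gᵀ)
      = G * (Gᵀ * G) * Om * (Gᵀ * G) * Gᵀ + G * (Gᵀ * G₀) * Om₀ * (G₀ᵀ * G) * Gᵀ := by
        rw [hS]; simp only [Matrix.mul_add, Matrix.add_mul, Matrix.mul_assoc]
    _ = _ := by simp [hG, h2]

end Envelope

/-- A tensor whose mode-`k` fibers lie in the column spaces of the bases `G k` is fixed by the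
projection onto their tensor product. -/
lemma kron_mulVec_coef {m p : ℕ} {r u : Fin m → ℕ} {B : CoefTensor r p}
    {G : ∀ k, Matrix (Fin (r k)) (Fin (u k)) ℝ}
    {R : ∀ k, Submodule ℝ (EuclideanSpace ℝ (Fin (r k)))} (hG : ∀ k, IsBasisMatrix (G k) (R k))
    (hB : ∀ k, modeSpan B k ≤ R k) (a : Fin p) :
    kron (fun k => G k * (G k)ᵀ) *ᵥ (fun i => B i a) = fun i => B i a := by
  refine kron_mulVec_eq_self _ _ fun k i => ?_
  have := (hG k).mul_transpose_mulVec (hB k (Submodule.subset_span ⟨(i, a), rfl⟩))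
  have := congrFun this (i k)
  simpa [Matrix.mulVec, dotProduct] using this

/-! ### Measurability of the matrix inverse -/

section Measurability

variable {α : Type*} [MeasurableSpace α] {p : ℕ}

/-- The inverse is the adjugate times the inverted determinant; with the value `0` at singular
matrices this formula holds everywhere. -/
lemma measurable_matrix_inv {M : α → Matrix (Fin p) (Fin p) ℝ}
    (hM : ∀ a b, Measurable fun x => M x a b) (a b : Fin p) :
    Measurable fun x => (M x)⁻¹ a b := by
  have hM' : Measurable fun x => (fun a b => M x a b : Fin p → Fin p → ℝ) :=
    measurable_pi_lambda _ fun a => measurable_pi_lambda _ fun b => hM a b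
  have hid : Continuous fun m : Fin p → Fin p → ℝ => (Matrix.of m : Matrix (Fin p) (Fin p) ℝ) :=
    continuous_id
  have h1 := hid.matrix_det.measurable.comp hM'
  have h2 := (hid.matrix_adjugate.matrix_elem a b).measurable.comp hM'
  simp only [Matrix.inv_def, Ring.inverse_eq_inv', Matrix.smul_apply, smul_eq_mul]
  exact h1.inv.mul h2

end Measurability

/-! ### Integrating out the errors given the predictors -/

section Conditional

variable {Ω : Type*} [MeasurableSpace Ω] {P : Measure Ω} [IsProbabilityMeasure P]
  {α : Type*} [MeasurableSpace α]

/-- Independence across `i` and within each pair makes the joint law a product of all the marginals;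
regrouping the factors separates predictors from errors. -/
lemma indepFun_pi_of_iIndepFun_prodMk {β : Type*} [MeasurableSpace β] {n : ℕ}
    {X : Fin n → Ω → α} {ε : Fin n → Ω → β}
    (hX : ∀ i, Measurable (X i)) (hε : ∀ i, Measurable (ε i))
    (hind : iIndepFun (fun i ω => (X i ω, ε i ω)) P) (hXε : ∀ i, IndepFun (X i) (ε i) P) :
    P.map (fun ω => (fun i => X i ω, fun i => ε i ω)) =
      (P.map fun ω i => X i ω).prod (Measure.pi fun i => P.map (ε i)) := by
  have _ : ∀ i, IsProbabilityMeasure (P.map (X i)) :=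
    fun i => Measure.isProbabilityMeasure_map (hX i).aemeasurable
  have _ : ∀ i, IsProbabilityMeasure (P.map (ε i)) :=
    fun i => Measure.isProbabilityMeasure_map (hε i).aemeasurable
  have h1 := hind.map_fun_eq_pi_map fun i => ((hX i).prodMk (hε i)).aemeasurable
  have h2 : ∀ i, P.map (fun ω => (X i ω, ε i ω)) = (P.map (X i)).prod (P.map (ε i)) := fun i =>
    (indepFun_iff_map_prod_eq_prod_map_map (hX i).aemeasurable (hε i).aemeasurable).1 (hXε i)
  simp only [h2] at h1
  have h3 := measurePreserving_arrowProdEquivProdArrow α β (Fin n)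
    (fun i => P.map (X i)) (fun i => P.map (ε i))
  have hXind : iIndepFun X P := hind.comp (fun _ => Prod.fst) fun _ => measurable_fst
  have h4 := hXind.map_fun_eq_pi_map fun i => (hX i).aemeasurable
  rw [h4, ← h3.map_eq, ← h1, Measure.map_map h3.measurable
    (measurable_pi_lambda _ fun i => (hX i).prodMk (hε i))]
  rfl

variable {E : Type*} [NormedAddCommGroup E] [InnerProductSpace ℝ E] [MeasurableSpace E]
  [BorelSpace E] [SecondCountableTopology E]

/-- Integrating out independent errors `ε i`, given the predictors `X i`. -/
lemma integral_mul_exp_sum_inner {n : ℕ} {X : Fin n → Ω → α} {ε : Fin n → Ω → E}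
    (hX : ∀ i, Measurable (X i)) (hε : ∀ i, Measurable (ε i))
    (hind : iIndepFun (fun i ω => (X i ω, ε i ω)) P) (hXε : ∀ i, IndepFun (X i) (ε i) P)
    {v : (Fin n → α) → Fin n → E} (hv : Measurable v)
    {ρ : (Fin n → α) → ℂ} (hρ : Measurable ρ) (hρ1 : ∀ x, ‖ρ x‖ ≤ 1) :
    ∫ ω, ρ (fun i => X i ω) *
        Complex.exp ((∑ t, inner ℝ (ε t ω) (v (fun i => X i ω) t) : ℝ) * Complex.I) ∂P =
      ∫ ω, ρ (fun i => X i ω) * ∏ t, charFun (P.map (ε t)) (v (fun i => X i ω) t) ∂P := by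
  have _ : ∀ i, IsProbabilityMeasure (P.map (ε i)) :=
    fun i => Measure.isProbabilityMeasure_map (hε i).aemeasurable
  have hXm : Measurable fun ω i => X i ω := measurable_pi_lambda _ hX
  have hεm : Measurable fun ω i => ε i ω := measurable_pi_lambda _ hε
  have _ : IsProbabilityMeasure (P.map fun ω i => X i ω) :=
    Measure.isProbabilityMeasure_map hXm.aemeasurable
  have hvt : ∀ t, Measurable fun x => v x t := fun t => (measurable_pi_apply t).comp hv
  let F : (Fin n → α) × (Fin n → E) → ℂ := fun z => ρ z.1 *
    Complex.exp ((∑ t, inner ℝ (z.2 t) (v z.1 t) : ℝ) * Complex.I)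
  have hF : Measurable F := by
    refine (hρ.comp measurable_fst).mul (Complex.measurable_exp.comp
      ((Complex.measurable_ofReal.comp ?_).mul_const _))
    refine Finset.measurable_sum _ fun t _ => ?_
    exact ((measurable_pi_apply t).comp measurable_snd).inner ((hvt t).comp measurable_fst)
  have hF1 : ∀ z, ‖F z‖ ≤ 1 := by
    intro z
    rw [norm_mul, Complex.norm_exp_ofReal_mul_I, mul_one]
    exact hρ1 _
  have hcf : ∀ t, Measurable fun x => charFun (P.map (ε t)) (v x t) := fun t =>
    (continuous_charFun).measurable.comp (hvt t)
  calc ∫ ω, F (fun i => X i ω, fun i => ε i ω) ∂P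
      = ∫ z, F z ∂(P.map (fun ω => (fun i => X i ω, fun i => ε i ω))) :=
        (integral_map (hXm.prodMk hεm).aemeasurable hF.aestronglyMeasurable).symm
    _ = ∫ x, ∫ e, F (x, e) ∂(Measure.pi fun i => P.map (ε i)) ∂(P.map fun ω i => X i ω) := by
        rw [indepFun_pi_of_iIndepFun_prodMk hX hε hind hXε]
        refine integral_prod _ ?_
        exact Integrable.of_bound hF.aestronglyMeasurable 1 (ae_of_all _ hF1)
    _ = ∫ x, ρ x * ∏ t, charFun (P.map (ε t)) (v x t) ∂(P.map fun ω i => X i ω) := by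
        -- For fixed predictors the exponential factorizes over `t`, and the product measure turns
        -- its integral into a product of characteristic functions.
        refine integral_congr_ae (ae_of_all _ fun x => ?_)
        simp only [F]
        rw [integral_const_mul]
        congr 1
        simp only [charFun_apply]
        rw [← integral_fintype_prod_eq_prod
          (f := fun t e => Complex.exp ((inner ℝ e (v x t) : ℝ) * Complex.I))]
        simp only [Complex.ofReal_sum, Finset.sum_mul, Complex.exp_sum]
    _ = _ := by
        rw [integral_map hXm.aemeasurable]
        exact (hρ.mul (Finset.measurable_fun_prod _ fun t _ => hcf t)).aestronglyMeasurable

end Conditional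

/-! ### Strong law for Gram matrices -/

section LargeNumbers

variable {Ω : Type*} [MeasurableSpace Ω] {P : Measure Ω} {p : ℕ}

/-- The `p × n` matrix with columns `x t`. -/
def design {p n : ℕ} (x : Fin n → Fin p → ℝ) : Matrix (Fin p) (Fin n) ℝ := Matrix.of fun a t => x t a

/-- The Gram matrix `𝕏 𝕏ᵀ` of a sample of predictors. -/
def gram {p n : ℕ} (x : Fin n → Fin p → ℝ) : Matrix (Fin p) (Fin p) ℝ := design x * (design x)ᵀ

lemma gram_apply {n : ℕ} (x : Fin n → Fin p → ℝ) (a b : Fin p) :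
    gram x a b = ∑ t, x t a * x t b := rfl

lemma gram_center_apply {n : ℕ} (x : Fin n → Fin p → ℝ) (a b : Fin p) :
    gram (center x) a b = gram x a b - (n : ℝ)⁻¹ * (∑ t, x t a) * ∑ t, x t b := by
  simp only [gram_apply, center, Pi.sub_apply, Pi.smul_apply, Finset.sum_apply, smul_eq_mul]
  set sa := ∑ t, x t a
  set sb := ∑ t, x t b
  have h : ∀ t, (x t a - (n : ℝ)⁻¹ * sa) * (x t b - (n : ℝ)⁻¹ * sb) =
      x t a * x t b - x t a * ((n : ℝ)⁻¹ * sb) - (n : ℝ)⁻¹ * sa * x t b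
        + (n : ℝ)⁻¹ * sa * ((n : ℝ)⁻¹ * sb) := fun t => by ring
  simp only [h, Finset.sum_add_distrib, Finset.sum_sub_distrib, ← Finset.mul_sum,
    ← Finset.sum_mul, Finset.sum_const, Finset.card_univ, Fintype.card_fin, nsmul_eq_mul]
  change _ - sa * _ - _ * sb + _ = _
  -- The empty sample is covered by the convention `0⁻¹ = 0`.
  rcases eq_or_ne (n : ℝ) 0 with hn | hn
  · simp [hn]
  · field_simp
    ring

variable {X : ℕ → Ω → Fin p → ℝ}

lemma ae_tendsto_mean_comp (hindep : iIndepFun X P)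
    (hXid : ∀ i, IdentDistrib (X i) (X 0) P P) {f : (Fin p → ℝ) → ℝ} (hf : Measurable f)
    (hint : Integrable (fun ω => f (X 0 ω)) P) :
    ∀ᵐ ω ∂P, Tendsto (fun n : ℕ => (n : ℝ)⁻¹ * ∑ t : Fin n, f (X t ω)) atTop
      (𝓝 (∫ ω, f (X 0 ω) ∂P)) := by
  have h := strong_law_ae (μ := P) (fun i ω => f (X i ω)) hint
    (fun i j hij => (hindep.indepFun hij).comp hf hf) (fun i => (hXid i).comp hf)
  filter_upwards [h] with ω hω
  simpa only [Finset.sum_range, smul_eq_mul] using hω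

lemma memLp_apply (hX2 : MemLp (X 0) 2 P) (a : Fin p) : MemLp (fun ω => X 0 ω a) 2 P :=
  memLp_pi_iff.1 hX2 a

lemma ae_tendsto_gram (hindep : iIndepFun X P)
    (hXid : ∀ i, IdentDistrib (X i) (X 0) P P) (hX2 : MemLp (X 0) 2 P) :
    ∀ᵐ ω ∂P, ∀ a b, Tendsto (fun n : ℕ => (n : ℝ)⁻¹ * gram (fun t : Fin n => X t ω) a b) atTop
      (𝓝 (∫ ω, X 0 ω a * X 0 ω b ∂P)) := by
  rw [ae_all_iff]; intro a
  rw [ae_all_iff]; intro b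
  exact ae_tendsto_mean_comp hindep hXid (f := fun x => x a * x b) (by fun_prop)
    ((memLp_apply hX2 a).integrable_mul (memLp_apply hX2 b))

variable [IsProbabilityMeasure P]

lemma ae_tendsto_gram_of_mean_zero (hindep : iIndepFun X P)
    (hXid : ∀ i, IdentDistrib (X i) (X 0) P P) (hX2 : MemLp (X 0) 2 P)
    (h0 : ∀ a, ∫ ω, X 0 ω a ∂P = 0) :
    ∀ᵐ ω ∂P, Tendsto (fun n : ℕ => (n : ℝ)⁻¹ • gram (fun t : Fin n => X t ω)) atTop
      (𝓝 (covMatrix P (X 0))) := by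
  filter_upwards [ae_tendsto_gram hindep hXid hX2] with ω h
  refine tendsto_pi_nhds.2 fun a => tendsto_pi_nhds.2 fun b => ?_
  simpa [covMatrix, covariance_eq_sub (memLp_apply hX2 a) (memLp_apply hX2 b), h0] using h a b

lemma ae_tendsto_gram_center (hindep : iIndepFun X P)
    (hXid : ∀ i, IdentDistrib (X i) (X 0) P P) (hX2 : MemLp (X 0) 2 P) :
    ∀ᵐ ω ∂P, Tendsto (fun n : ℕ => (n : ℝ)⁻¹ • gram (center fun t : Fin n => X t ω)) atTop
      (𝓝 (covMatrix P (X 0))) := by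
  have hm : ∀ᵐ ω ∂P, ∀ a, Tendsto (fun n : ℕ => (n : ℝ)⁻¹ * ∑ t : Fin n, X t ω a) atTop
      (𝓝 (∫ ω, X 0 ω a ∂P)) := by
    rw [ae_all_iff]; intro a
    exact ae_tendsto_mean_comp hindep hXid (f := fun x => x a) (by fun_prop)
      ((memLp_apply hX2 a).integrable one_le_two)
  filter_upwards [ae_tendsto_gram hindep hXid hX2, hm] with ω h h'
  refine tendsto_pi_nhds.2 fun a => tendsto_pi_nhds.2 fun b => ?_
  have := (h a b).sub ((h' a).mul (h' b))
  simp only [covMatrix, Matrix.of_apply,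
    covariance_eq_sub (memLp_apply hX2 a) (memLp_apply hX2 b)]
  refine this.congr fun n => ?_
  rw [Matrix.smul_apply, gram_center_apply, smul_eq_mul]
  ring

end LargeNumbers

/-! ### Least squares weights -/

section Weights

variable {p n : ℕ}

/-- The weights `(𝕏 𝕏ᵀ)⁻¹ 𝕏` of ordinary least squares. -/
noncomputable def weights (x : Fin n → Fin p → ℝ) : Matrix (Fin p) (Fin n) ℝ := (gram x)⁻¹ * design x

lemma weights_mul_transpose (x : Fin n → Fin p → ℝ) : weights x * (weights x)ᵀ = (gram x)⁻¹ := by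
  have hsymm : (gram x)ᵀ = gram x := by simp [gram]
  rw [weights, Matrix.transpose_mul, Matrix.transpose_nonsing_inv, hsymm, Matrix.mul_assoc,
    ← Matrix.mul_assoc (design x), ← gram]
  -- In the singular case both sides vanish, the inverse being `0` by convention.
  by_cases h : IsUnit (gram x).det
  · rw [Matrix.mul_nonsing_inv _ h, Matrix.mul_one]
  · rw [Matrix.nonsing_inv_apply_not_isUnit _ h, Matrix.zero_mul]

lemma weights_mul_design (x : Fin n → Fin p → ℝ) :
    weights x * (design x)ᵀ = (gram x)⁻¹ * gram x := by
  rw [weights, Matrix.mul_assoc, gram]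

/-- Weights are linear combinations of centered coordinates, which sum to zero. Hence a shift common
to all responses has no effect, and the errors may be left uncentered. -/
lemma sum_weights_center (x : Fin n → Fin p → ℝ) (a : Fin p) :
    ∑ t, weights (center x) a t = 0 := by
  have h : ∀ b, ∑ t, center x t b = 0 := by
    intro b
    rcases Nat.eq_zero_or_pos n with rfl | hn
    · simp
    have hn' : (n : ℝ) ≠ 0 := by positivity
    simp [center, Finset.sum_apply, hn']
  simp only [weights, Matrix.mul_apply]
  rw [Finset.sum_comm]
  refine Finset.sum_eq_zero fun b _ => ?_
  rw [← Finset.mul_sum]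
  simp [design, h]

end Weights

/-! ### The estimation error as a linear form in the errors -/

section Estimator

variable {m p n : ℕ} {r u : Fin m → ℕ}

/-- Error of an estimator that is linear in the responses: the contribution of the errors `e t`,
and the bias in case the Gram matrix is singular. -/
noncomputable def estimationError {p n : ℕ} {ι : Type*} [Fintype ι] (K : Matrix ι ι ℝ) (B : ι → Fin p → ℝ)
    (x : Fin n → Fin p → ℝ) (e : Fin n → ι → ℝ) : EuclideanSpace ℝ (Fin p × ι) :=
  WithLp.toLp 2 fun z => ∑ t, weights x z.1 t * (K *ᵥ e t) z.2 +
    ∑ b, ((gram x)⁻¹ * gram x - 1) z.1 b * B z.2 b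

lemma envelopeEstimator_apply (G : ∀ k, Matrix (Fin (r k)) (Fin (u k)) ℝ)
    (x : Fin n → Fin p → ℝ) (y : Fin n → Tensor r) (i : ∀ k, Fin (r k)) (a : Fin p) :
    envelopeEstimator G x y i a =
      ∑ t, weights x a t * (kron (fun k => G k * (G k)ᵀ) *ᵥ y t) i := by
  simp only [← tucker_tucker_transpose]
  simp only [envelopeEstimator, tuckerCoef, ols]
  rw [tucker]
  simp only [Finset.mul_sum]
  rw [Finset.sum_comm]
  refine Finset.sum_congr rfl fun t _ => ?_
  rw [tucker, Finset.mul_sum]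
  refine Finset.sum_congr rfl fun j _ => ?_
  simp only [weights, gram, design]
  ring

/-- Since `K` fixes `B`, the signal contributes `(gram x)⁻¹ * gram x` applied to `B`, which is `B`
itself unless the Gram matrix is singular. The shift `c` accommodates the mean error of a centered
sample. -/
lemma vecCoef_envelopeEstimator_sub {G : ∀ k, Matrix (Fin (r k)) (Fin (u k)) ℝ}
    {B : CoefTensor r p} {x : Fin n → Fin p → ℝ} {y e : Fin n → Tensor r} {c : Tensor r}
    (hB : ∀ a, kron (fun k => G k * (G k)ᵀ) *ᵥ (fun i => B i a) = fun i => B i a)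
    (hy : ∀ t, y t = modeVecProd B (x t) + e t + c)
    (hc : ∀ a, (∑ t, weights x a t) • c = 0) :
    vecCoef (envelopeEstimator G x y) - vecCoef B =
      estimationError (kron fun k => G k * (G k)ᵀ) B x e := by
  set K := kron fun k => G k * (G k)ᵀ with hK
  have hBx : ∀ t, K *ᵥ modeVecProd B (x t) = modeVecProd B (x t) := by
    intro t
    have h : modeVecProd B (x t) = ∑ a, x t a • fun i => B i a := by
      ext i; simp [modeVecProd, Finset.sum_apply, mul_comm]
    rw [h, Matrix.mulVec_sum]
    simp only [Matrix.mulVec_smul, hB]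
  ext ⟨a, i⟩
  have h1 : ∑ t, weights x a t * (K *ᵥ c) i = 0 := by
    rw [← Finset.sum_mul, ← smul_eq_mul, ← Pi.smul_apply, ← Matrix.mulVec_smul, hc]
    simp
  have h2 : ∑ t, weights x a t * modeVecProd B (x t) i =
      ∑ b, ((gram x)⁻¹ * gram x) a b * B i b := by
    rw [← weights_mul_design]
    simp only [modeVecProd, Matrix.mul_apply, Finset.mul_sum, Finset.sum_mul]
    rw [Finset.sum_comm]
    refine Finset.sum_congr rfl fun b _ => Finset.sum_congr rfl fun t _ => ?_
    simp only [design, Matrix.transpose_apply, Matrix.of_apply]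
    ring
  have h3 : ∑ b, (1 : Matrix (Fin p) (Fin p) ℝ) a b * B i b = B i a := by
    simp [Matrix.one_apply]
  simp only [vecCoef, estimationError, PiLp.sub_apply, envelopeEstimator_apply, ← hK, hy,
    Matrix.mulVec_add, Pi.add_apply, hBx, mul_add, Finset.sum_add_distrib, h1, h2, Matrix.sub_apply,
    sub_mul, Finset.sum_sub_distrib, h3]
  ring

end Estimator

/-! ### Linear forms of the error and their conditional variance -/

section QuadraticForm

variable {p n : ℕ} {ι : Type*} [Fintype ι]

/-- This form is linear in the entries of `M`, so measurability and limits can be taken entrywise in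
the inverse Gram matrix. -/
lemma dotProduct_kronecker_mulVec (M : Matrix (Fin p) (Fin p) ℝ) (N : Matrix ι ι ℝ)
    (s : Fin p × ι → ℝ) :
    s ⬝ᵥ (M ⊗ₖ N) *ᵥ s =
      ∑ a, ∑ b, M a b * ((fun i => s (a, i)) ⬝ᵥ N *ᵥ fun i => s (b, i)) := by
  simp only [dotProduct, Matrix.mulVec, Fintype.sum_prod_type, Matrix.kroneckerMap_apply,
    Finset.mul_sum]
  refine Finset.sum_congr rfl fun a _ => ?_
  rw [Finset.sum_comm]
  refine Finset.sum_congr rfl fun b _ => Finset.sum_congr rfl fun i _ =>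
    Finset.sum_congr rfl fun j _ => ?_
  ring

/-- The coefficient vector of the error `e t` in a linear form of the estimation error. -/
noncomputable def loading (K : Matrix ι ι ℝ) (s : Fin p × ι → ℝ) (x : Fin n → Fin p → ℝ) (t : Fin n) : ι → ℝ :=
  Kᵀ *ᵥ ∑ a, weights x a t • fun i => s (a, i)

lemma inner_estimationError (K : Matrix ι ι ℝ) (B : ι → Fin p → ℝ) (x : Fin n → Fin p → ℝ)
    (e : Fin n → ι → ℝ) (s : EuclideanSpace ℝ (Fin p × ι)) :
    inner ℝ (estimationError K B x e) s =
      ∑ t, inner ℝ (WithLp.toLp 2 (e t) : EuclideanSpace ℝ ι)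
        (WithLp.toLp 2 (loading K s x t)) +
      ∑ z : Fin p × ι, (∑ b, ((gram x)⁻¹ * gram x - 1) z.1 b * B z.2 b) * s z := by
  have h : ∀ t, inner ℝ (WithLp.toLp 2 (e t) : EuclideanSpace ℝ ι)
      (WithLp.toLp 2 (loading K s x t)) =
      ∑ z : Fin p × ι, weights x z.1 t * (K *ᵥ e t) z.2 * s z := by
    intro t
    rw [EuclideanSpace.inner_toLp_toLp, star_trivial, loading, Matrix.mulVec_transpose,
      ← Matrix.dotProduct_mulVec, dotProduct, Fintype.sum_prod_type, Finset.sum_comm]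
    refine Finset.sum_congr rfl fun i _ => ?_
    rw [Finset.sum_apply, Finset.sum_mul]
    refine Finset.sum_congr rfl fun a _ => ?_
    simp only [Pi.smul_apply, smul_eq_mul]
    ring
  simp only [h]
  rw [Finset.sum_comm, ← Finset.sum_add_distrib, PiLp.inner_apply]
  refine Finset.sum_congr rfl fun z _ => ?_
  simp only [estimationError, RCLike.inner_apply, conj_trivial]
  rw [mul_comm, add_mul, Finset.sum_mul]

/-- For errors with covariance `T`, this is the conditional variance of a linear form of the error;
the weights enter only through `weights x * (weights x)ᵀ = (gram x)⁻¹`. -/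
lemma sum_loading_quadratic (K T : Matrix ι ι ℝ) (s : Fin p × ι → ℝ) (x : Fin n → Fin p → ℝ) :
    ∑ t, loading K s x t ⬝ᵥ T *ᵥ loading K s x t = s ⬝ᵥ ((gram x)⁻¹ ⊗ₖ (K * T * Kᵀ)) *ᵥ s := by
  rw [dotProduct_kronecker_mulVec, ← weights_mul_transpose]
  have h : ∀ t, loading K s x t ⬝ᵥ T *ᵥ loading K s x t =
      ∑ a, ∑ b, weights x a t * weights x b t *
        ((fun i => s (a, i)) ⬝ᵥ (K * T * Kᵀ) *ᵥ fun i => s (b, i)) := by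
    intro t
    rw [loading]
    generalize hw : (∑ a, weights x a t • fun i => s (a, i)) = w
    have : Kᵀ *ᵥ w ⬝ᵥ T *ᵥ Kᵀ *ᵥ w = w ⬝ᵥ (K * T * Kᵀ) *ᵥ w := by
      rw [Matrix.mulVec_transpose, ← Matrix.dotProduct_mulVec, ← Matrix.mulVec_transpose,
        Matrix.mulVec_mulVec, Matrix.mulVec_mulVec, Matrix.mul_assoc]
    rw [this, ← hw, sum_dotProduct]
    refine Finset.sum_congr rfl fun a _ => ?_
    rw [Matrix.mulVec_sum, dotProduct_sum]
    refine Finset.sum_congr rfl fun b _ => ?_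
    rw [Matrix.mulVec_smul, smul_dotProduct, dotProduct_smul, smul_eq_mul, smul_eq_mul,
      ← mul_assoc (weights x a t)]
  simp only [h, Matrix.mul_apply, Matrix.transpose_apply, Finset.sum_mul]
  rw [Finset.sum_comm]
  refine Finset.sum_congr rfl fun a _ => ?_
  rw [Finset.sum_comm]

end QuadraticForm

/-! ### Measurability of the estimation error -/

section Measurability

variable {p n : ℕ}

lemma measurable_gram_apply (a b : Fin p) :
    Measurable fun x : Fin n → Fin p → ℝ => gram x a b := by
  simp only [gram_apply]
  fun_prop

lemma measurable_weights_apply (a : Fin p) (t : Fin n) :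
    Measurable fun x : Fin n → Fin p → ℝ => weights x a t := by
  simp only [weights, Matrix.mul_apply, design, Matrix.of_apply]
  refine Finset.measurable_fun_sum _ fun b _ => ?_
  exact (measurable_matrix_inv measurable_gram_apply a b).mul (by fun_prop)

lemma measurable_inv_gram_mul_gram_sub_one (a b : Fin p) :
    Measurable fun x : Fin n → Fin p → ℝ => ((gram x)⁻¹ * gram x - 1) a b := by
  simp only [Matrix.sub_apply, Matrix.mul_apply]
  refine (Finset.measurable_fun_sum _ fun c _ => ?_).sub_const _
  exact (measurable_matrix_inv measurable_gram_apply a c).mul (measurable_gram_apply c b)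

variable {ι : Type*} [Fintype ι]

lemma measurable_loading (K : Matrix ι ι ℝ) (s : Fin p × ι → ℝ) (t : Fin n) :
    Measurable fun x : Fin n → Fin p → ℝ => loading K s x t := by
  refine measurable_pi_lambda _ fun i => ?_
  simp only [loading, Matrix.mulVec, dotProduct, Finset.sum_apply, Pi.smul_apply, smul_eq_mul]
  refine Finset.measurable_fun_sum _ fun j _ => (Finset.measurable_fun_sum _ fun a _ => ?_).const_mul _
  exact (measurable_weights_apply a t).mul_const _

lemma measurable_estimationError {Ω : Type*} [MeasurableSpace Ω] (K : Matrix ι ι ℝ)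
    (B : ι → Fin p → ℝ) {x : Ω → Fin n → Fin p → ℝ} {e : Ω → Fin n → ι → ℝ}
    (hx : Measurable x) (he : Measurable e) :
    Measurable fun ω => estimationError K B (x ω) (e ω) := by
  refine (WithLp.measurable_toLp 2 _).comp (measurable_pi_lambda _ fun z => ?_)
  refine (Finset.measurable_fun_sum _ fun t _ => ?_).add (Finset.measurable_fun_sum _ fun b _ => ?_)
  · refine ((measurable_weights_apply z.1 t).comp hx).mul ?_
    simp only [Matrix.mulVec, dotProduct]
    fun_prop
  · exact ((measurable_inv_gram_mul_gram_sub_one z.1 b).comp hx).mul_const _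

lemma measurable_center : Measurable fun x : Fin n → Fin p → ℝ => center x := by
  unfold center
  fun_prop

end Measurability

/-! ### Convergence of characteristic functions -/

section Limit

variable {Ω : Type*} [MeasurableSpace Ω] {P : Measure Ω} [IsProbabilityMeasure P]
  {p : ℕ} {ι : Type*} [Fintype ι]

/-- The bias term of a linear form of the estimation error, from singular Gram matrices. -/
noncomputable def biasForm {p n : ℕ} {ι : Type*} [Fintype ι] (B : ι → Fin p → ℝ) (s : Fin p × ι → ℝ)
    (x : Fin n → Fin p → ℝ) : ℝ :=
  √(n : ℝ) * ∑ z : Fin p × ι, (∑ b, ((gram x)⁻¹ * gram x - 1) z.1 b * B z.2 b) * s z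

lemma measurable_biasForm {n : ℕ} (B : ι → Fin p → ℝ) (s : Fin p × ι → ℝ) :
    Measurable (biasForm (n := n) B s) := by
  refine (Finset.measurable_fun_sum _ fun z _ => ?_).const_mul _
  refine (Finset.measurable_fun_sum _ fun b _ => ?_).mul_const _
  exact (measurable_inv_gram_mul_gram_sub_one z.1 b).mul_const _

lemma posSemidef_limit {Sig : Matrix (Fin p) (Fin p) ℝ} (hSig : Sig.PosDef) {T : Matrix ι ι ℝ}
    (hT : T.PosSemidef) (K : Matrix ι ι ℝ) : (Sig⁻¹ ⊗ₖ (K * T * Kᵀ)).PosSemidef := by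
  refine hSig.inv.posSemidef.kronecker ?_
  rw [← Matrix.conjTranspose_eq_transpose_of_trivial]
  exact hT.mul_mul_conjTranspose_same K

variable [DecidableEq ι]

/-- The characteristic function of the scaled estimation error: given the predictors, the error
is Gaussian. -/
lemma charFun_map_estimationError {n : ℕ} {T : Matrix ι ι ℝ} (hT : T.PosSemidef)
    (K : Matrix ι ι ℝ) (B : ι → Fin p → ℝ)
    {X : Fin n → Ω → Fin p → ℝ} {ε : Fin n → Ω → ι → ℝ}
    (hXmeas : ∀ i, Measurable (X i)) (hεmeas : ∀ i, Measurable (ε i))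
    (hindep : iIndepFun (fun i ω => (X i ω, ε i ω)) P) (hXε : ∀ i, IndepFun (X i) (ε i) P)
    (hεlaw : ∀ i, P.map (fun ω => (WithLp.toLp 2 (ε i ω) : EuclideanSpace ℝ ι)) =
      multivariateGaussian 0 T)
    {g : (Fin n → Fin p → ℝ) → Fin n → Fin p → ℝ} (hg : Measurable g)
    (s : EuclideanSpace ℝ (Fin p × ι)) :
    charFun (P.map fun ω => √(n : ℝ) • estimationError K B (g fun t => X t ω) fun t => ε t ω) s =
      ∫ ω, Complex.exp ((biasForm B s (g fun t => X t ω) : ℝ) * Complex.I) *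
        Complex.exp ((-(n * (s ⬝ᵥ ((gram (g fun t => X t ω))⁻¹ ⊗ₖ (K * T * Kᵀ)) *ᵥ s) / 2) : ℝ)) ∂P := by
  have hXm : Measurable fun ω t => X t ω := measurable_pi_lambda _ hXmeas
  have hεm : Measurable fun ω t => ε t ω := measurable_pi_lambda _ hεmeas
  have htoLp : Measurable (WithLp.toLp 2 : (ι → ℝ) → EuclideanSpace ℝ ι) :=
    WithLp.measurable_toLp 2 _
  have hv : Measurable fun (x : Fin n → Fin p → ℝ) (t : Fin n) =>
      √(n : ℝ) • (WithLp.toLp 2 (loading K s (g x) t) : EuclideanSpace ℝ ι) :=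
    measurable_pi_lambda _ fun t =>
      Measurable.const_smul (g := fun x => (WithLp.toLp 2 (loading K s (g x) t) :
        EuclideanSpace ℝ ι)) (htoLp.comp ((measurable_loading K s t).comp hg)) √(n : ℝ)
  -- The bias depends on the predictors alone, so it enters as a phase `ρ` of modulus one.
  have hρ : Measurable fun x : Fin n → Fin p → ℝ =>
      Complex.exp ((biasForm B s (g x) : ℝ) * Complex.I) :=
    Complex.measurable_exp.comp ((Complex.measurable_ofReal.comp
      ((measurable_biasForm B s).comp hg)).mul_const _)
  have key := integral_mul_exp_sum_inner (P := P) (X := X)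
    (ε := fun i ω => (WithLp.toLp 2 (ε i ω) : EuclideanSpace ℝ ι)) hXmeas
    (fun i => htoLp.comp (hεmeas i))
    (hindep.comp (fun _ z => (z.1, (WithLp.toLp 2 z.2 : EuclideanSpace ℝ ι)))
      fun _ => measurable_fst.prodMk (htoLp.comp measurable_snd))
    (fun i => (hXε i).comp measurable_id htoLp) hv hρ
    (fun x => (Complex.norm_exp_ofReal_mul_I _).le)
  have hD : Measurable fun ω =>
      √(n : ℝ) • estimationError K B (g fun t => X t ω) fun t => ε t ω :=
    Measurable.const_smul (measurable_estimationError K B (hg.comp hXm) hεm) √(n : ℝ)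
  rw [charFun_apply, integral_map hD.aemeasurable (by fun_prop)]
  calc _ = _ := ?_
    _ = _ := key
    _ = _ := ?_
  · refine integral_congr_ae (ae_of_all _ fun ω => ?_)
    simp only [← Complex.exp_add, ← add_mul, ← Complex.ofReal_add]
    congr 3
    rw [real_inner_smul_left, inner_estimationError, mul_add, add_comm, biasForm, Finset.mul_sum]
    simp only [inner_smul_right, Finset.mul_sum]
  · refine integral_congr_ae (ae_of_all _ fun ω => ?_)
    simp only [hεlaw, charFun_multivariateGaussian hT]
    congr 1
    -- The Gaussian exponents add up to the conditional variance; the two factors `√n` combine to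
    -- `n`.
    rw [← Complex.exp_sum, ← sum_loading_quadratic]
    congr 1
    rw [Finset.mul_sum, Finset.sum_div, ← Finset.sum_neg_distrib, Complex.ofReal_sum]
    refine Finset.sum_congr rfl fun t _ => ?_
    have hsq : √(n : ℝ) * √(n : ℝ) = n := Real.mul_self_sqrt (Nat.cast_nonneg n)
    simp only [inner_zero_right, Complex.ofReal_zero, zero_mul, zero_sub, WithLp.ofLp_smul,
      Matrix.mulVec_smul, smul_dotProduct, dotProduct_smul, smul_eq_mul, ← mul_assoc, hsq]
    push_cast
    ring

lemma tendsto_charFun_estimationError {T : Matrix ι ι ℝ} (hT : T.PosSemidef)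
    (K : Matrix ι ι ℝ) (B : ι → Fin p → ℝ)
    {X : ℕ → Ω → Fin p → ℝ} {ε : ℕ → Ω → ι → ℝ}
    (hXmeas : ∀ i, Measurable (X i)) (hεmeas : ∀ i, Measurable (ε i))
    (hindep : iIndepFun (fun i ω => (X i ω, ε i ω)) P) (hXε : ∀ i, IndepFun (X i) (ε i) P)
    (hεlaw : ∀ i, P.map (fun ω => (WithLp.toLp 2 (ε i ω) : EuclideanSpace ℝ ι)) =
      multivariateGaussian 0 T)
    {g : ∀ n : ℕ, (Fin n → Fin p → ℝ) → Fin n → Fin p → ℝ} (hg : ∀ n, Measurable (g n))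
    {Sig : Matrix (Fin p) (Fin p) ℝ} (hSig : Sig.PosDef)
    (hgram : ∀ᵐ ω ∂P, Tendsto (fun n : ℕ => (n : ℝ)⁻¹ • gram (g n fun t : Fin n => X t ω)) atTop
      (𝓝 Sig)) (s : EuclideanSpace ℝ (Fin p × ι)) :
    Tendsto (fun n : ℕ => charFun (P.map fun ω =>
      √(n : ℝ) • estimationError K B (g n fun t : Fin n => X t ω) fun t => ε t ω) s) atTop
      (𝓝 (charFun (multivariateGaussian 0 (Sig⁻¹ ⊗ₖ (K * T * Kᵀ))) s)) := by
  have hfin : ∀ n : ℕ, iIndepFun (fun (i : Fin n) ω => (X i ω, ε i ω)) P := fun n =>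
    hindep.precomp Fin.val_injective
  have hKT : (K * T * Kᵀ).PosSemidef := by
    rw [← Matrix.conjTranspose_eq_transpose_of_trivial]
    exact hT.mul_mul_conjTranspose_same K
  have hgrampos : ∀ {n : ℕ} (x : Fin n → Fin p → ℝ), (gram x).PosSemidef := fun x => by
    rw [gram, ← Matrix.conjTranspose_eq_transpose_of_trivial]
    exact Matrix.posSemidef_self_mul_conjTranspose _
  simp only [fun n : ℕ => charFun_map_estimationError hT K B (fun i : Fin n => hXmeas i)
    (fun i => hεmeas i) (hfin n) (fun i => hXε i) (fun i => hεlaw i) (hg n) s]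
  have hlim : charFun (multivariateGaussian 0 (Sig⁻¹ ⊗ₖ (K * T * Kᵀ))) s =
      ∫ _, Complex.exp ((-((s ⬝ᵥ (Sig⁻¹ ⊗ₖ (K * T * Kᵀ)) *ᵥ s) / 2) : ℝ)) ∂P := by
    rw [charFun_multivariateGaussian (posSemidef_limit hSig hT K)]
    simp
  rw [hlim]
  have hXm : ∀ n : ℕ, Measurable fun ω (t : Fin n) => X t ω := fun n =>
    measurable_pi_lambda _ fun t => hXmeas t
  refine tendsto_integral_of_dominated_convergence (fun _ => 1) (fun n => ?_)
    (integrable_const _) (fun n => ae_of_all _ fun ω => ?_) ?_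
  · refine Measurable.aestronglyMeasurable (.mul ?_ ?_)
    · exact Complex.measurable_exp.comp ((Complex.measurable_ofReal.comp
        ((measurable_biasForm B s).comp ((hg n).comp (hXm n)))).mul_const _)
    · refine Complex.measurable_exp.comp (Complex.measurable_ofReal.comp ?_)
      refine (Measurable.div_const (.const_mul ?_ _) _).neg
      simp only [dotProduct_kronecker_mulVec]
      refine Finset.measurable_fun_sum _ fun a _ => Finset.measurable_fun_sum _ fun b _ => ?_
      exact ((measurable_matrix_inv measurable_gram_apply a b).comp
        ((hg n).comp (hXm n))).mul_const _
  -- Domination by `1`: the quadratic form is nonnegative, even where the Gram matrix is singular.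
  · rw [norm_mul, Complex.norm_exp_ofReal_mul_I, one_mul, Complex.norm_exp, Complex.ofReal_re,
      Real.exp_le_one_iff, neg_nonpos]
    have := ((hgrampos (g n fun t : Fin n => X t ω)).inv.kronecker hKT).dotProduct_mulVec_nonneg
      s.ofLp
    rw [star_trivial] at this
    positivity
  · filter_upwards [hgram] with ω hω
    -- The determinants of the scaled Gram matrices tend to a positive number, and a vanishing
    -- determinant of `gram` would make the scaled one vanish too.
    have hdet : ∀ᶠ n : ℕ in atTop, IsUnit (gram (g n fun t : Fin n => X t ω)).det := by
      have h := ((continuous_id.matrix_det).tendsto Sig).comp hω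
      filter_upwards [h.eventually_ne hSig.det_pos.ne'] with n hn
      rw [isUnit_iff_ne_zero]
      intro h0
      apply hn
      simp only [Function.comp, id, Matrix.det_smul, h0, mul_zero]
    have hinv : Tendsto (fun n : ℕ => ((n : ℝ)⁻¹ • gram (g n fun t : Fin n => X t ω))⁻¹) atTop
        (𝓝 Sig⁻¹) := by
      refine (continuousAt_matrix_inv Sig ?_).tendsto.comp hω
      rw [Ring.inverse_eq_inv']
      exact continuousAt_inv₀ hSig.det_pos.ne'
    have hq : Tendsto (fun n : ℕ => (n : ℝ) *
        (s ⬝ᵥ ((gram (g n fun t : Fin n => X t ω))⁻¹ ⊗ₖ (K * T * Kᵀ)) *ᵥ s)) atTop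
        (𝓝 (s ⬝ᵥ (Sig⁻¹ ⊗ₖ (K * T * Kᵀ)) *ᵥ s)) := by
      simp only [dotProduct_kronecker_mulVec]
      have : Tendsto (fun n : ℕ => ∑ a, ∑ b,
          ((n : ℝ)⁻¹ • gram (g n fun t : Fin n => X t ω))⁻¹ a b *
            ((fun i => s (a, i)) ⬝ᵥ (K * T * Kᵀ) *ᵥ fun i => s (b, i))) atTop
          (𝓝 (∑ a, ∑ b, Sig⁻¹ a b *
            ((fun i => s (a, i)) ⬝ᵥ (K * T * Kᵀ) *ᵥ fun i => s (b, i)))) :=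
        tendsto_finsetSum _ fun a _ => tendsto_finsetSum _ fun b _ =>
          ((tendsto_pi_nhds.1 (tendsto_pi_nhds.1 hinv a) b).mul_const _)
      refine this.congr' ?_
      filter_upwards [hdet, eventually_gt_atTop 0] with n hn hn0
      have hn0' : (n : ℝ) ≠ 0 := by positivity
      have h1 : ((n : ℝ)⁻¹ • gram (g n fun t : Fin n => X t ω))⁻¹ =
          (n : ℝ) • (gram (g n fun t : Fin n => X t ω))⁻¹ := by
        refine Matrix.inv_eq_right_inv ?_
        rw [Matrix.smul_mul, Matrix.mul_smul, smul_smul, inv_mul_cancel₀ hn0', one_smul,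
          Matrix.mul_nonsing_inv _ hn]
      simp only [h1, Matrix.smul_apply, smul_eq_mul, Finset.mul_sum, mul_assoc]
    have hbias : ∀ᶠ n : ℕ in atTop,
        Complex.exp ((biasForm B s (g n fun t : Fin n => X t ω) : ℝ) * Complex.I) = 1 := by
      filter_upwards [hdet] with n hn
      simp [biasForm, Matrix.nonsing_inv_mul _ hn]
    have hexp : Tendsto (fun n : ℕ => Complex.exp ((-(n * (s ⬝ᵥ
        ((gram (g n fun t : Fin n => X t ω))⁻¹ ⊗ₖ (K * T * Kᵀ)) *ᵥ s) / 2) : ℝ))) atTop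
        (𝓝 (Complex.exp ((-((s ⬝ᵥ (Sig⁻¹ ⊗ₖ (K * T * Kᵀ)) *ᵥ s) / 2) : ℝ)))) :=
      ((Complex.continuous_exp.comp Complex.continuous_ofReal).tendsto _).comp
        (hq.div_const 2).neg
    refine hexp.congr' ?_
    filter_upwards [hbias] with n hn
    rw [hn, one_mul]

end Limit

/-! ### From characteristic functions to the asymptotic statements -/

section Conclusion

variable {Ω : Type*} [MeasurableSpace Ω] {P : Measure Ω} [IsProbabilityMeasure P]
  {m p : ℕ} {r : Fin m → ℕ} {Bhat : ℕ → Ω → CoefTensor r p} {B : CoefTensor r p}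

lemma isSqrtConsistent_of_tendsto_charFun
    (hmeas : ∀ n : ℕ, Measurable fun ω => √(n : ℝ) • (vecCoef (Bhat n ω) - vecCoef B))
    {U : Matrix (Fin p × (∀ k, Fin (r k))) (Fin p × (∀ k, Fin (r k))) ℝ}
    (h : ∀ s, Tendsto (fun n : ℕ =>
      charFun (P.map fun ω => √(n : ℝ) • (vecCoef (Bhat n ω) - vecCoef B)) s) atTop
      (𝓝 (charFun (multivariateGaussian 0 U) s))) : IsSqrtConsistent P Bhat B := by
  have _ : ∀ n : ℕ, IsProbabilityMeasure
      (P.map fun ω => √(n : ℝ) • (vecCoef (Bhat n ω) - vecCoef B)) :=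
    fun n => Measure.isProbabilityMeasure_map (hmeas n).aemeasurable
  -- Convergence to a limit continuous at the origin forces tightness, so a single `M` serves all
  -- `n`.
  have ht := tendsto_measure_norm_gt_of_isTightMeasureSet
    (isTightMeasureSet_of_tendsto_charFun continuous_charFun.continuousAt h)
  simp only [iSup_range] at ht
  intro δ hδ
  obtain ⟨M, hM⟩ := (ht.eventually_le_const hδ).exists
  refine ⟨M, Eventually.of_forall fun n => ?_⟩
  refine le_trans ?_ (iSup_le_iff.1 hM n)
  rw [Measure.map_apply (hmeas n) (measurableSet_lt measurable_const measurable_norm)]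
  refine measure_mono fun ω hω => ?_
  simpa [norm_smul, abs_of_nonneg (Real.sqrt_nonneg _)] using hω

lemma isAsymptoticallyNormal_of_tendsto_charFun
    (hmeas : ∀ n : ℕ, Measurable fun ω => √(n : ℝ) • (vecCoef (Bhat n ω) - vecCoef B))
    {U : Matrix (Fin p × (∀ k, Fin (r k))) (Fin p × (∀ k, Fin (r k))) ℝ}
    (h : ∀ s, Tendsto (fun n : ℕ =>
      charFun (P.map fun ω => √(n : ℝ) • (vecCoef (Bhat n ω) - vecCoef B)) s) atTop
      (𝓝 (charFun (multivariateGaussian 0 U) s))) : IsAsymptoticallyNormal P Bhat B U where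
  forall_aemeasurable n := (hmeas n).aemeasurable
  aemeasurable_limit := aemeasurable_id
  tendsto := by
    refine ProbabilityMeasure.tendsto_of_tendsto_charFun ?_
    simpa using h

end Conclusion

/-- Both asymptotic statements, for the estimator computed from transformed predictors `g n X`
and responses that satisfy the model up to a common shift orthogonal to the weights. -/
lemma envelopeEstimator_asymptotics {Ω : Type*} [MeasurableSpace Ω] {P : Measure Ω}
    [IsProbabilityMeasure P] {m p : ℕ} {r u : Fin m → ℕ} {B : CoefTensor r p}
    {S : ∀ k, Matrix (Fin (r k)) (Fin (r k)) ℝ} (hS : ∀ k, (S k).PosDef)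
    {G : ∀ k, Matrix (Fin (r k)) (Fin (u k)) ℝ}
    (hB : ∀ a, kron (fun k => G k * (G k)ᵀ) *ᵥ (fun i => B i a) = fun i => B i a)
    {X : ℕ → Ω → Fin p → ℝ} {ε : ℕ → Ω → Tensor r}
    (hXmeas : ∀ i, Measurable (X i)) (hεmeas : ∀ i, Measurable (ε i))
    (hindep : iIndepFun (fun i ω => (X i ω, ε i ω)) P) (hXε : ∀ i, IndepFun (X i) (ε i) P)
    (hεlaw : ∀ i, HasLaw (fun ω => vec (ε i ω)) (multivariateGaussian 0 (kron S)) P)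
    {Sig : Matrix (Fin p) (Fin p) ℝ} (hSig : Sig.PosDef)
    {g : ∀ n : ℕ, (Fin n → Fin p → ℝ) → Fin n → Fin p → ℝ} (hg : ∀ n, Measurable (g n))
    (hgram : ∀ᵐ ω ∂P, Tendsto (fun n : ℕ => (n : ℝ)⁻¹ • gram (g n fun t : Fin n => X t ω)) atTop
      (𝓝 Sig))
    {y : ∀ n : ℕ, Ω → Fin n → Tensor r} {c : ℕ → Ω → Tensor r}
    (hy : ∀ n ω t, y n ω t = modeVecProd B (g n (fun t : Fin n => X t ω) t) + ε t ω + c n ω)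
    (hc : ∀ n ω a, (∑ t, weights (g n fun t : Fin n => X t ω) a t) • c n ω = 0) :
    IsSqrtConsistent P (fun n ω => envelopeEstimator G (g n fun t : Fin n => X t ω) (y n ω)) B ∧
      IsAsymptoticallyNormal P
        (fun n ω => envelopeEstimator G (g n fun t : Fin n => X t ω) (y n ω)) B
        (asymptoticCov Sig S G) := by
  set K := kron fun k => G k * (G k)ᵀ with hK
  have herr : ∀ n ω, vecCoef (envelopeEstimator G (g n fun t : Fin n => X t ω) (y n ω)) -
      vecCoef B = estimationError K B (g n fun t : Fin n => X t ω) fun t => ε t ω := fun n ω =>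
    vecCoef_envelopeEstimator_sub hB (hy n ω) (hc n ω)
  have hU : asymptoticCov Sig S G = Sig⁻¹ ⊗ₖ (K * kron S * Kᵀ) := by
    rw [hK, transpose_kron, kron_mul_kron, kron_mul_kron, asymptoticCov]
    simp
  have hlim := tendsto_charFun_estimationError (posSemidef_kron fun k => (hS k).posSemidef) K B
    hXmeas hεmeas hindep hXε (fun i => (hεlaw i).map_eq) hg hSig hgram
  have hmeas : ∀ n : ℕ, Measurable fun ω => √(n : ℝ) •
      (vecCoef (envelopeEstimator G (g n fun t : Fin n => X t ω) (y n ω)) - vecCoef B) := by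
    intro n
    simp only [herr]
    exact Measurable.const_smul (measurable_estimationError K B
      ((hg n).comp (measurable_pi_lambda _ fun t => hXmeas t))
      (measurable_pi_lambda _ fun t => hεmeas t)) √(n : ℝ)
  have hlim' : ∀ s, Tendsto (fun n : ℕ => charFun (P.map fun ω => √(n : ℝ) •
      (vecCoef (envelopeEstimator G (g n fun t : Fin n => X t ω) (y n ω)) - vecCoef B)) s) atTop
      (𝓝 (charFun (multivariateGaussian 0 (asymptoticCov Sig S G)) s)) := by
    simp only [herr, hU]
    exact hlim
  exact ⟨isSqrtConsistent_of_tendsto_charFun hmeas hlim',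
    isAsymptoticallyNormal_of_tendsto_charFun hmeas hlim'⟩

lemma center_model {m p n : ℕ} {r : Fin m → ℕ} {B : CoefTensor r p} {μ₀ : Tensor r}
    {x : Fin n → Fin p → ℝ} {e y : Fin n → Tensor r}
    (hy : ∀ t, y t = μ₀ + modeVecProd B (x t) + e t) (t : Fin n) :
    center y t = modeVecProd B (center x t) + e t + -((n : ℝ)⁻¹ • ∑ s, e s) := by
  -- The index `t` witnesses a nonempty sample, which the cancellation of the intercept requires.
  have hn : (n : ℝ) ≠ 0 := by
    have := t.pos
    positivity
  have hsum : ∑ s, modeVecProd B (x s) = modeVecProd B (∑ s, x s) := by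
    ext i
    simp only [modeVecProd, Finset.sum_apply, Finset.mul_sum]
    rw [Finset.sum_comm]
  have hlin : modeVecProd B (center x t) =
      modeVecProd B (x t) - (n : ℝ)⁻¹ • modeVecProd B (∑ s, x s) := by
    ext i
    simp only [modeVecProd, center, Pi.sub_apply, Pi.smul_apply, smul_eq_mul, mul_sub,
      Finset.sum_sub_distrib, Finset.mul_sum]
    congr 1
    refine Finset.sum_congr rfl fun a _ => ?_
    ring
  rw [hlin]
  simp only [center, hy, Finset.sum_add_distrib, hsum, Finset.sum_const, Finset.card_univ,
    Fintype.card_fin, smul_add]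
  rw [← Nat.cast_smul_eq_nsmul ℝ, smul_smul, inv_mul_cancel₀ hn, one_smul]
  abel

end TensorEnvelope

theorem mainTheorem4 {Ω : Type*} [MeasurableSpace Ω] (P : Measure Ω) [IsProbabilityMeasure P]
    {m p : ℕ} {r u : Fin m → ℕ}
    -- parameters: intercept, coefficient tensor, covariance factors
    (μ₀ : TensorEnvelope.Tensor r) (B : TensorEnvelope.CoefTensor r p)
    (S : ∀ k, Matrix (Fin (r k)) (Fin (r k)) ℝ) (hS : ∀ k, (S k).PosDef)
    -- the known envelope bases
    (G : ∀ k, Matrix (Fin (r k)) (Fin (u k)) ℝ)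
    (hG : ∀ k, TensorEnvelope.IsBasisMatrix (G k)
      (TensorEnvelope.envelope (S k) (TensorEnvelope.modeSpan B k)))
    -- predictors, errors, responses
    (X : ℕ → Ω → Fin p → ℝ) (ε Y : ℕ → Ω → TensorEnvelope.Tensor r)
    (hXmeas : ∀ i, Measurable (X i)) (hεmeas : ∀ i, Measurable (ε i))
    (hindep : iIndepFun (fun i ω => (X i ω, ε i ω)) P)
    (hXε : ∀ i, IndepFun (X i) (ε i) P)
    (hXid : ∀ i, IdentDistrib (X i) (X 0) P P)
    (hX2 : MemLp (X 0) 2 P) (hXpos : (TensorEnvelope.covMatrix P (X 0)).PosDef)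
    (hεlaw : ∀ i, HasLaw (fun ω => TensorEnvelope.vec (ε i ω))
      (multivariateGaussian 0 (TensorEnvelope.kron S)) P)
    (hY : ∀ i ω, Y i ω = μ₀ + TensorEnvelope.modeVecProd B (X i ω) + ε i ω) :
    -- the estimator from the sample centered at its means
    (TensorEnvelope.IsSqrtConsistent P
        (fun n ω => TensorEnvelope.envelopeEstimator G
          (TensorEnvelope.center fun t : Fin n => X t ω)
          (TensorEnvelope.center fun t : Fin n => Y t ω)) B ∧
      TensorEnvelope.IsAsymptoticallyNormal P
        (fun n ω => TensorEnvelope.envelopeEstimator G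
          (TensorEnvelope.center fun t : Fin n => X t ω)
          (TensorEnvelope.center fun t : Fin n => Y t ω)) B
        (TensorEnvelope.asymptoticCov (TensorEnvelope.covMatrix P (X 0)) S G)) ∧
    -- the estimator from the uncentered sample, when intercept and predictor mean vanish
    (μ₀ = 0 → (∀ a, ∫ ω, X 0 ω a ∂P = 0) →
      TensorEnvelope.IsSqrtConsistent P
        (fun n ω => TensorEnvelope.envelopeEstimator G
          (fun t : Fin n => X t ω) (fun t : Fin n => Y t ω)) B ∧
      TensorEnvelope.IsAsymptoticallyNormal P
        (fun n ω => TensorEnvelope.envelopeEstimator G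
          (fun t : Fin n => X t ω) (fun t : Fin n => Y t ω)) B
        (TensorEnvelope.asymptoticCov (TensorEnvelope.covMatrix P (X 0)) S G)) ∧
    -- the second form of the asymptotic covariance
    (∃ (G₀ : ∀ k, Matrix (Fin (r k)) (Fin (r k - u k)) ℝ)
      (Om : ∀ k, Matrix (Fin (u k)) (Fin (u k)) ℝ)
      (Om₀ : ∀ k, Matrix (Fin (r k - u k)) (Fin (r k - u k)) ℝ),
      ∀ k, TensorEnvelope.IsDecomposition (S k) (G k) (G₀ k) (Om k) (Om₀ k)) ∧
    (∀ (G₀ : ∀ k, Matrix (Fin (r k)) (Fin (r k - u k)) ℝ)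
      (Om : ∀ k, Matrix (Fin (u k)) (Fin (u k)) ℝ)
      (Om₀ : ∀ k, Matrix (Fin (r k - u k)) (Fin (r k - u k)) ℝ),
      (∀ k, TensorEnvelope.IsDecomposition (S k) (G k) (G₀ k) (Om k) (Om₀ k)) →
      TensorEnvelope.asymptoticCov (TensorEnvelope.covMatrix P (X 0)) S G =
        (TensorEnvelope.covMatrix P (X 0))⁻¹ ⊗ₖ
        TensorEnvelope.kron fun k => G k * Om k * (G k)ᵀ) := by
  have hfix := TensorEnvelope.kron_mulVec_coef hG fun k => TensorEnvelope.le_envelope _ _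
  have hXind : iIndepFun X P := hindep.comp (fun _ => Prod.fst) fun _ => measurable_fst
  refine ⟨?_, ?_, ?_, ?_⟩
  · refine TensorEnvelope.envelopeEstimator_asymptotics hS hfix hXmeas hεmeas hindep hXε hεlaw hXpos
      (g := fun n x => TensorEnvelope.center x) (fun n => TensorEnvelope.measurable_center)
      (TensorEnvelope.ae_tendsto_gram_center hXind hXid hX2)
      -- The common shift is minus the mean error.
      (fun n ω t => TensorEnvelope.center_model (fun s => hY s ω) t) fun n ω a => ?_
    rw [TensorEnvelope.sum_weights_center, zero_smul]
  · intro hμ h0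
    refine TensorEnvelope.envelopeEstimator_asymptotics hS hfix hXmeas hεmeas hindep hXε hεlaw hXpos
      (g := fun n x => x) (fun n => measurable_id)
      (TensorEnvelope.ae_tendsto_gram_of_mean_zero hXind hXid hX2 h0)
      (c := fun _ _ => 0) (fun n ω t => ?_) fun n ω a => smul_zero _
    rw [hY, hμ, zero_add, add_zero]
  · choose G₀ Om Om₀ h using fun k => (hG k).exists_isDecomposition (hS k)
      (TensorEnvelope.isReducing_envelope (hS k).1 _)
    exact ⟨G₀, Om, Om₀, h⟩
  · intro G₀ Om Om₀ h
    rw [TensorEnvelope.asymptoticCov]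
    congr 2
    ext1 k
    exact (h k).proj_mul_proj (hG k).1
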